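/- Let $N\ge 1$, let $\mathbb T=\mathbb R/\mathbb Z$ be identified with $[0,1)$, and let functions be real- or complex-valued. Let $\mathcal D$ be the set of dyadic subintervals $[k2^{-n},(k+1)2^{-n})$ of $[0,1)$, let $h_I=|I|^{-1/2}(\chi_{I^+}-\chi_{I^-})$ for $I\in\mathcal D$, where $I^+,I^-$ are the right and left halves of $I$, and for $R=I_1\times\cdots\times I_n\in\mathcal D^n$ put $h_R(t)=\prod_j h_{I_j}(t_j)$ and $f_R=\langle f,h_R\rangle$. - $\mathrm{bmo}(\mathbb T^N)$ is the space of $f\in L^2(\mathbb T^N)$ with $\sup_R\frac1{|R|}\int_R|f-m_Rf|<\infty$, where $R$ runs over all products of $N$ intervals (arcs) of $\mathbb T$ and $m_Rf=\frac1{|R|}\int_Rf$. - $\mathrm{BMO}^d(\mathbb T^n)$ is the space of $f\in L^2(\mathbb T^n)$ with $$\|f\|_{\mathrm{BMO}^d(\mathbb T^n)}:=\sup_{\Omega}\Big(\frac1{|\Omega|}\sum_{R\in\mathcal D^n,\,R\subseteq\Omega}|f_R|^2\Big)^{1/2}<\infty ,$$ where $\Omega$ runs over all nonempty open subsets of $\mathbb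 T^n$. (Functions are taken modulo those whose coefficients $f_R$ all vanish; no mean-zero condition is imposed.) - For $\varphi\in L^2(\mathbb T^N)$, a set $S\subset\{1,\dots,N\}$ of $N_1$ variables with $0<N_1<N$ and a dyadic rectangle $R\in\mathcal D^{N_1}$ in these variables, $m_R\varphi(t)=\frac1{|R|}\int_R\varphi(s,t)\,ds$ is a function of the other $N-N_1$ variables $t$. The space $\mathrm{BMO}^d_m(\mathbb T^N)$ consists of all $\varphi\in L^2(\mathbb T^N)$ for which there is a constant $C$ such that $m_R\varphi\in\mathrm{BMO}^d(\mathbb T^{N-N_1})$ and $\|m_R\varphi\|_{\mathrm{BMO}^d(\mathbb T^{N-N_1})}\le C$ for all such $S$ and $R$. **Proposition.** Let $\varphi\in L^2(\mathbb T^N)$. If $\varphi f\in\mathrm{BMO}^d(\mathbb T^N)$ for every $f\in\mathrm{bmo}(\mathbb T^N)$, then $\varphi\in\mathrm{BMO}^d_m(\mathbb T^N)$. -/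

import Mathlib

open MeasureTheory
open scoped ENNReal NNReal

noncomputable section

namespace ProductBMO

/-- The torus whose coordinates are indexed by `ι`; `Torus (Fin N)` is `𝕋^N`. Its `volume` is the
product of the normalised Lebesgue measures on `𝕋 = ℝ / ℤ`. -/
abbrev Torus (ι : Type) : Type := ι → UnitAddCircle

/-- The interval (arc) of `𝕋 = ℝ / ℤ` that starts at `a` and has length `ℓ`, where
`0 < ℓ ≤ 1` in every use below. -/
def arc (a ℓ : ℝ) : Set UnitAddCircle := (fun x : ℝ => (x : UnitAddCircle)) '' Set.Ico a (a + ℓ)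

/-- A dyadic subinterval `[k / 2 ^ n, (k + 1) / 2 ^ n)` of `[0, 1)`, `0 ≤ k < 2 ^ n`. -/
structure DyadicInterval where
  level : ℕ
  index : Fin (2 ^ level)

namespace DyadicInterval

/-- The length `|I| = 2 ^ (-n)`. -/
def length (I : DyadicInterval) : ℝ := 1 / 2 ^ I.level

/-- The left endpoint `k / 2 ^ n`. -/
def left (I : DyadicInterval) : ℝ := (I.index : ℕ) / 2 ^ I.level

def toSet (I : DyadicInterval) : Set UnitAddCircle := arc I.left I.length

def leftHalf (I : DyadicInterval) : Set UnitAddCircle := arc I.left (I.length / 2)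

def rightHalf (I : DyadicInterval) : Set UnitAddCircle :=
  arc (I.left + I.length / 2) (I.length / 2)

/-- The Haar function `h_I = |I| ^ (-1/2) (χ_{I⁺} - χ_{I⁻})`, where `I⁺` and `I⁻` are the right and
left halves of `I`. -/
def haar (I : DyadicInterval) (t : UnitAddCircle) : ℝ :=
  (Real.sqrt I.length)⁻¹ * (I.rightHalf.indicator 1 t - I.leftHalf.indicator 1 t)

end DyadicInterval

/-- Dyadic rectangles, with one dyadic interval for every coordinate in `ι`. -/
abbrev DyadicRectangle (ι : Type) : Type := ι → DyadicInterval

namespace DyadicRectangle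

variable {ι : Type}

def toSet (R : DyadicRectangle ι) : Set (Torus ι) := Set.univ.pi fun i => (R i).toSet

/-- The product Haar function `h_R`. -/
def haar [Fintype ι] (R : DyadicRectangle ι) (t : Torus ι) : ℝ := ∏ i, (R i).haar (t i)

end DyadicRectangle

section Spaces

variable {𝕜 : Type} [RCLike 𝕜] {ι : Type} [Fintype ι]

/-- The Haar coefficient `f_R = ⟨f, h_R⟩`. -/
def haarCoeff (f : Torus ι → 𝕜) (R : DyadicRectangle ι) : 𝕜 :=
  ∫ t, f t * ((DyadicRectangle.haar R t : ℝ) : 𝕜)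

/-- The dyadic product BMO seminorm:
`sup_Ω ( |Ω|⁻¹ ∑_{R ⊆ Ω} |f_R|² ) ^ (1/2)`, with `Ω` running over the nonempty open sets and `R`
over the dyadic rectangles. -/
def dyadicBMONorm (f : Torus ι → 𝕜) : ℝ≥0∞ :=
  ⨆ (Ω : Set (Torus ι)) (_ : IsOpen Ω) (_ : Ω.Nonempty),
    ((∑' R : {R : DyadicRectangle ι // R.toSet ⊆ Ω}, ‖haarCoeff f R.1‖ₑ ^ 2) / volume Ω)
      ^ (1 / 2 : ℝ)

/-- The average oscillation norm of `bmo`: the supremum of `|R|⁻¹ ∫_R |f - m_R f|` over all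
rectangles `R`, that is, products of arcs. -/
def littleBMONorm (f : Torus ι → 𝕜) : ℝ≥0∞ :=
  ⨆ (a : ι → ℝ) (ℓ : ι → ℝ) (_ : ∀ i, 0 < ℓ i ∧ ℓ i ≤ 1),
    (∫⁻ t in Set.univ.pi fun i => arc (a i) (ℓ i),
        ‖f t - ⨍ u in Set.univ.pi fun i => arc (a i) (ℓ i), f u‖ₑ) /
      volume (Set.univ.pi fun i => arc (a i) (ℓ i))

variable (ι 𝕜)

/-- `BMO^d`, as a space of functions in `L²` modulo those with vanishing product Haar coefficients:
`f ∈ L²` belongs to it when its orthogonal projection `∑_R f_R h_R` onto `L²₀` has finite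
`BMO^d` norm. -/
def dyadicBMO : Set (Torus ι → 𝕜) :=
  {f | MemLp f 2 volume ∧ dyadicBMONorm f < ∞}

/-- The little BMO space `bmo` of functions of bounded mean oscillation on all rectangles. -/
def littleBMO : Set (Torus ι → 𝕜) :=
  {f | MemLp f 2 volume ∧ littleBMONorm f < ∞}

end Spaces

/-- The pointwise multipliers from `X` to `Y`. -/
def multipliers {α 𝕜 : Type} [Mul 𝕜] (X Y : Set (α → 𝕜)) : Set (α → 𝕜) :=
  {φ | ∀ f ∈ X, (fun t => φ t * f t) ∈ Y}

section Mean

variable {𝕜 : Type} [RCLike 𝕜] {ι : Type} [DecidableEq ι]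

/-- The point of the torus with coordinates `s` in the directions of `S` and `t` in the others. -/
def glue (S : Finset ι) (s : Torus {i // i ∈ S}) (t : Torus {i // i ∉ S}) : Torus ι :=
  fun i => if h : i ∈ S then s ⟨i, h⟩ else t ⟨i, h⟩

/-- The partial average `m_R φ` over a dyadic rectangle `R` in the variables of `S`, a function of
the remaining variables. -/
def partialMean (φ : Torus ι → 𝕜) (S : Finset ι) (R : DyadicRectangle {i // i ∈ S})
    (t : Torus {i // i ∉ S}) : 𝕜 :=
  ⨍ s in R.toSet, φ (glue S s t)

variable (ι 𝕜)

/-- The mean dyadic product BMO space: the partial averages over dyadic rectangles in any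
`0 < N₁ < N` of the variables are in `BMO^d` of the remaining variables, uniformly. As for
`dyadicBMO`, functions are in `L²` and need not have mean zero in each variable. -/
def meanDyadicBMO [Fintype ι] : Set (Torus ι → 𝕜) :=
  {φ | MemLp φ 2 volume ∧ ∃ C : ℝ≥0, ∀ S : Finset ι, 0 < S.card → S.card < Fintype.card ι →
    ∀ R : DyadicRectangle {i // i ∈ S},
      partialMean φ S R ∈ dyadicBMO 𝕜 {i // i ∉ S} ∧ dyadicBMONorm (partialMean φ S R) ≤ C}

end Mean

end ProductBMO

end

noncomputable section

namespace ProductBMO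

/-! Only bounded test functions `f` are needed. Since they lie in `bmo`
(`mem_littleBMO_of_bounded`), `φ f` is in `BMO^d` for each `f ∈ L^∞`, and the uniform boundedness
principle turns this into one constant `C` on the unit ball of `L^∞`
(`exists_dyadicBMONorm_mul_le`).

Given `R` in the variables of `S`, test with `f = √|R| h_R`, of modulus `χ_R`. As `h_R² = χ_R /
|R|`, pairing `φ f` with `h_R ⊗ h_Q` averages `φ` over `R`: the coefficient at `R × Q` is `√|R|`
times that of `m_R φ` at `Q` (`haarCoeff_mul_signHaar`). For open `Ω`, the bound on a product `U ×
Ω` with `U ⊇ R` open and `|U| ≤ 2|R|` gives `|R| ∑_{Q ⊆ Ω} |(m_R φ)_Q|² ≤ 2 C² |R| |Ω|`. Dividing by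
`|R|` gives the bound `√2 C`, independent of `S` and `R` (`dyadicBMONorm_partialMean_le`). -/

/-! ### Arcs of the circle. -/

theorem injOn_coe_Ico (a : ℝ) :
    Set.InjOn (fun x : ℝ => (x : UnitAddCircle)) (Set.Ico a (a + 1)) := fun _ hx _ hy h =>
  (AddCircle.coe_eq_coe_iff_of_mem_Ico (p := (1 : ℝ)) (a := a) hx hy).1 h

theorem measurableSet_arc (a : ℝ) {ℓ : ℝ} (hℓ : ℓ ≤ 1) : MeasurableSet (arc a ℓ) :=
  measurableSet_Ico.image_of_measurable_injOn AddCircle.measurable_mk'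
    ((injOn_coe_Ico a).mono (Set.Ico_subset_Ico_right (by linarith)))

theorem volume_arc (a : ℝ) {ℓ : ℝ} (hℓ : ℓ ≤ 1) : volume (arc a ℓ) = ENNReal.ofReal ℓ := by
  rw [AddCircle.add_projection_respects_measure (T := 1) a (measurableSet_arc a hℓ)]
  have h1 : volume (Set.Ioo a (a + ℓ)) = ENNReal.ofReal ℓ := by simp
  -- Measure on the circle is computed on the fundamental domain `(a, a + 1]`, while arcs are closed
  -- on the left. The point `a` of the arc is then represented by `a + 1`, at no cost in measure.
  have h2 : volume (Set.Icc a (a + ℓ) ∪ {a + 1}) ≤ ENNReal.ofReal ℓ := by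
    refine (measure_union_le _ _).trans ?_
    simp
  refine le_antisymm ((measure_mono ?_).trans h2) (h1 ▸ measure_mono ?_)
  · rintro x ⟨⟨y, hy, hyx⟩, hx⟩
    rcases hx.2.lt_or_eq with hlt | heq
    · have : y = x := injOn_coe_Ico a ⟨hy.1, by linarith [hy.2]⟩ ⟨hx.1.le, hlt⟩ hyx
      exact Or.inl ⟨this ▸ hy.1, this ▸ hy.2.le⟩
    · exact Or.inr heq
  · intro x hx
    exact ⟨⟨x, ⟨hx.1.le, hx.2⟩, rfl⟩, hx.1, by linarith [hx.2]⟩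

/-! ### Haar functions of dyadic intervals and rectangles. -/

namespace DyadicInterval

variable (I : DyadicInterval)

theorem length_pos : 0 < I.length := by unfold length; positivity

theorem length_le_one : I.length ≤ 1 := by
  unfold length
  exact div_le_one_of_le₀ (one_le_pow₀ (by norm_num)) (by positivity)

theorem leftHalf_union_rightHalf : I.leftHalf ∪ I.rightHalf = I.toSet := by
  have := I.length_pos
  unfold leftHalf rightHalf toSet arc
  rw [← Set.image_union, add_assoc, add_halves,
    Set.Ico_union_Ico_eq_Ico (by linarith) (by linarith)]

theorem disjoint_leftHalf_rightHalf : Disjoint I.leftHalf I.rightHalf := by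
  have := I.length_pos
  have := I.length_le_one
  unfold leftHalf rightHalf arc
  rw [add_assoc, add_halves]
  rw [Set.disjoint_iff_inter_eq_empty, ← (injOn_coe_Ico I.left).image_inter
    (Set.Ico_subset_Ico_right (by linarith)) (Set.Ico_subset_Ico (by linarith) (by linarith)),
    Set.image_eq_empty, ← Set.disjoint_iff_inter_eq_empty]
  exact Set.Ico_disjoint_Ico_same

theorem measurableSet_toSet : MeasurableSet I.toSet := measurableSet_arc _ I.length_le_one

theorem measurable_haar : Measurable I.haar := by
  have h0 := I.length_pos
  have h1 := I.length_le_one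
  have hr : MeasurableSet I.rightHalf := measurableSet_arc _ (by linarith)
  have hl : MeasurableSet I.leftHalf := measurableSet_arc _ (by linarith)
  exact ((measurable_one.indicator hr).sub (measurable_one.indicator hl)).const_mul _

theorem haar_mul_self (t : UnitAddCircle) :
    I.haar t * I.haar t = I.length⁻¹ * I.toSet.indicator 1 t := by
  have key : (I.rightHalf.indicator 1 t - I.leftHalf.indicator 1 t : ℝ)
      * (I.rightHalf.indicator 1 t - I.leftHalf.indicator 1 t) = I.toSet.indicator 1 t := by
    rw [← I.leftHalf_union_rightHalf]
    have hd : t ∈ I.leftHalf → t ∉ I.rightHalf :=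
      fun h => Set.disjoint_left.1 I.disjoint_leftHalf_rightHalf h
    by_cases hl : t ∈ I.leftHalf
    · simp [hl, hd hl]
    · by_cases hr : t ∈ I.rightHalf <;> simp [hl, hr]
  unfold haar
  rw [mul_mul_mul_comm, key, ← mul_inv, Real.mul_self_sqrt I.length_pos.le]

end DyadicInterval

namespace DyadicRectangle

variable {ι : Type} [Fintype ι] (R : DyadicRectangle ι)

/-- The volume `|R|` of a dyadic rectangle, as a product of lengths. -/
def vol : ℝ := ∏ i, (R i).length

theorem vol_pos : 0 < R.vol := Finset.prod_pos fun i _ => (R i).length_pos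

theorem measurableSet_toSet : MeasurableSet R.toSet :=
  MeasurableSet.univ_pi fun i => (R i).measurableSet_toSet

theorem volume_toSet : volume R.toSet = ENNReal.ofReal R.vol := by
  unfold toSet vol
  rw [volume_pi_pi, ENNReal.ofReal_prod_of_nonneg fun i _ => (R i).length_pos.le]
  exact Finset.prod_congr rfl fun i _ => volume_arc _ (R i).length_le_one

theorem measurable_haar : Measurable R.haar :=
  Finset.measurable_prod _ fun i _ => (R i).measurable_haar.comp (measurable_pi_apply i)

theorem haar_mul_self (t : Torus ι) :
    R.haar t * R.haar t = R.vol⁻¹ * R.toSet.indicator 1 t := by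
  unfold haar vol
  rw [← Finset.prod_mul_distrib, ← Finset.prod_inv_distrib]
  simp_rw [DyadicInterval.haar_mul_self]
  rw [Finset.prod_mul_distrib]
  congr 1
  by_cases h : t ∈ R.toSet
  · rw [Set.indicator_of_mem h]
    exact Finset.prod_eq_one fun i _ => Set.indicator_of_mem (h i trivial) _
  · rw [Set.indicator_of_notMem h]
    obtain ⟨i, hi⟩ : ∃ i, t i ∉ (R i).toSet := by
      by_contra! hc
      exact h fun i _ => hc i
    exact Finset.prod_eq_zero (Finset.mem_univ i) (Set.indicator_of_notMem hi _)

/-- The Haar function of `R` renormalised to have modulus `χ_R`. -/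
def signHaar (t : Torus ι) : ℝ := √R.vol * R.haar t

theorem measurable_signHaar : Measurable R.signHaar := R.measurable_haar.const_mul _

theorem abs_haar_le (t : Torus ι) : |R.haar t| ≤ (√R.vol)⁻¹ := by
  rw [← Real.sqrt_inv]
  refine Real.abs_le_sqrt ?_
  rw [sq, R.haar_mul_self]
  refine mul_le_of_le_one_right (inv_nonneg.2 R.vol_pos.le) ?_
  exact Set.indicator_le_self' (fun _ _ => zero_le_one) t

theorem abs_signHaar_le_one (t : Torus ι) : |R.signHaar t| ≤ 1 := by
  unfold signHaar
  rw [abs_mul, abs_of_nonneg (Real.sqrt_nonneg _)]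
  have h := Real.sqrt_pos.2 R.vol_pos
  calc √R.vol * |R.haar t| ≤ √R.vol * (√R.vol)⁻¹ := by gcongr; exact R.abs_haar_le t
    _ = 1 := mul_inv_cancel₀ h.ne'

/-- This identity makes a Haar coefficient of `φ f` in the `S` variables an average of `φ` over `R`.
-/
theorem signHaar_mul_haar (t : Torus ι) :
    R.signHaar t * R.haar t = (√R.vol)⁻¹ * R.toSet.indicator 1 t := by
  unfold signHaar
  rw [mul_assoc, R.haar_mul_self, ← mul_assoc]
  rw [← div_eq_mul_inv, Real.sqrt_div_self]

end DyadicRectangle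

/-! ### Bounded functions belong to `bmo`. -/

section Bounded

variable {𝕜 : Type} [RCLike 𝕜] {ι : Type} [Fintype ι]

theorem littleBMONorm_le {f : Torus ι → 𝕜} {M : ℝ} (hM : ∀ t, ‖f t‖ ≤ M) :
    littleBMONorm f ≤ ENNReal.ofReal (2 * M) := by
  unfold littleBMONorm
  refine iSup_le fun a => iSup_le fun ℓ => iSup_le fun _ => ?_
  set R : Set (Torus ι) := Set.univ.pi fun i => arc (a i) (ℓ i)
  have hM0 : 0 ≤ M := (norm_nonneg _).trans (hM 0)
  have hav : ‖⨍ u in R, f u‖ ≤ M := by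
    rw [setAverage_eq, norm_smul, norm_inv, Real.norm_of_nonneg measureReal_nonneg]
    have h := norm_setIntegral_le_of_norm_le_const (μ := volume) (s := R) (measure_lt_top _ _)
      (fun x _ => hM x)
    calc (volume.real R)⁻¹ * ‖∫ u in R, f u‖ ≤ (volume.real R)⁻¹ * (M * volume.real R) := by
          gcongr
      _ = M * ((volume.real R)⁻¹ * volume.real R) := by ring
      _ ≤ M := mul_le_of_le_one_right hM0 inv_mul_le_one
  refine ENNReal.div_le_of_le_mul ?_
  refine (lintegral_mono (g := fun _ => ENNReal.ofReal (2 * M)) fun t => ?_).trans ?_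
  · rw [← ofReal_norm]
    exact ENNReal.ofReal_le_ofReal ((norm_sub_le _ _).trans (by linarith [hM t]))
  · simp

theorem mem_littleBMO_of_bounded {f : Torus ι → 𝕜} (hf : AEStronglyMeasurable f volume) {M : ℝ}
    (hM : ∀ t, ‖f t‖ ≤ M) : f ∈ littleBMO 𝕜 ι :=
  ⟨.of_bound hf M (.of_forall hM), (littleBMONorm_le hM).trans_lt ENNReal.ofReal_lt_top⟩

end Bounded

/-- On a probability space the `L¹` norm is at most the `L²` norm; apply this to each slice, square,
and integrate by Tonelli. It puts partial means in `L²`. -/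
theorem memLp_two_setIntegral {𝕜 α β : Type*} [RCLike 𝕜] [MeasurableSpace α] [MeasurableSpace β]
    {μ : Measure α} [IsProbabilityMeasure μ] {ν : Measure β} [SFinite ν] {F : α × β → 𝕜}
    (hF : MemLp F 2 (μ.prod ν)) (A : Set α) :
    MemLp (fun t => ∫ s in A, F (s, t) ∂μ) 2 ν := by
  have hswap : AEStronglyMeasurable (fun z : β × α => F z.swap) (ν.prod μ) :=
    hF.1.prod_swap
  refine ⟨?_, ?_⟩
  · have : AEStronglyMeasurable (fun z : β × α => F z.swap) (ν.prod (μ.restrict A)) :=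
      hswap.mono_ac (Measure.AbsolutelyContinuous.rfl.prod Measure.restrict_le_self.absolutelyContinuous)
    exact this.integral_prod_right'
  · rw [eLpNorm_lt_top_iff_lintegral_rpow_enorm_lt_top (by norm_num) (by norm_num)]
    have h2 := lintegral_rpow_enorm_lt_top_of_eLpNorm_lt_top (by norm_num) (by norm_num) hF.2
    rw [lintegral_prod_symm _ (hF.1.enorm.pow_const _)] at h2
    refine lt_of_le_of_lt (lintegral_mono_ae ?_) h2
    filter_upwards [hswap.prodMk_left] with t ht
    have h1 : ‖∫ s in A, F (s, t) ∂μ‖ₑ ≤ eLpNorm (fun s => F (s, t)) 2 μ :=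
      calc ‖∫ s in A, F (s, t) ∂μ‖ₑ ≤ ∫⁻ s in A, ‖F (s, t)‖ₑ ∂μ := enorm_integral_le_lintegral_enorm _
        _ ≤ ∫⁻ s, ‖F (s, t)‖ₑ ∂μ := setLIntegral_le_lintegral _ _
        _ = eLpNorm (fun s => F (s, t)) 1 μ := eLpNorm_one_eq_lintegral_enorm.symm
        _ ≤ _ := eLpNorm_le_eLpNorm_of_exponent_le (by norm_num) ht
    rw [eLpNorm_eq_lintegral_rpow_enorm_toReal (by norm_num) (by norm_num)] at h1
    calc _ ≤ _ := ENNReal.rpow_le_rpow h1 (by norm_num)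
      _ = _ := by
        rw [← ENNReal.rpow_mul]
        norm_num

/-! ### Uniform boundedness of multiplication by `φ` on `L^∞`. -/

section UniformBound

variable {𝕜 : Type} [RCLike 𝕜] {ι : Type} [Fintype ι]

theorem dyadicBMONorm_le_iff {g : Torus ι → 𝕜} {c : ℝ≥0} :
    dyadicBMONorm g ≤ c ↔ ∀ Ω : Set (Torus ι), IsOpen Ω → Ω.Nonempty →
      (∑' R : {R : DyadicRectangle ι // R.toSet ⊆ Ω}, ‖haarCoeff g R.1‖ₑ ^ 2)
        ≤ (c : ℝ≥0∞) ^ 2 * volume Ω := by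
  unfold dyadicBMONorm
  simp only [iSup_le_iff]
  refine forall_congr' fun Ω => forall_congr' fun hΩ => forall_congr' fun hne => ?_
  have h0 : volume Ω ≠ 0 := (hΩ.measure_pos volume hne).ne'
  rw [one_div, ENNReal.rpow_inv_le_iff (by norm_num),
    ENNReal.div_le_iff_le_mul (Or.inl h0) (Or.inl (measure_ne_top _ _)), ENNReal.rpow_two]

/-- Finite partial sums involve finitely many continuous functionals, so each gives a finite
continuous seminorm, as uniform boundedness requires. -/
theorem dyadicBMONorm_le_iff_finset {g : Torus ι → 𝕜} {c : ℝ≥0} :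
    dyadicBMONorm g ≤ c ↔ ∀ Ω : Set (Torus ι), IsOpen Ω → Ω.Nonempty →
      ∀ F : Finset {R : DyadicRectangle ι // R.toSet ⊆ Ω},
        ∑ R ∈ F, ‖haarCoeff g R.1‖ ^ 2 ≤ (c : ℝ) ^ 2 * volume.real Ω := by
  rw [dyadicBMONorm_le_iff]
  refine forall_congr' fun Ω => forall_congr' fun hΩ => forall_congr' fun hne => ?_
  have hr : (c : ℝ≥0∞) ^ 2 * volume Ω = ENNReal.ofReal ((c : ℝ) ^ 2 * volume.real Ω) := by
    rw [ENNReal.ofReal_mul (by positivity), ENNReal.ofReal_pow c.coe_nonneg, ENNReal.ofReal_coe_nnreal,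
      ofReal_measureReal]
  have hl (F : Finset {R : DyadicRectangle ι // R.toSet ⊆ Ω}) :
      ∑ R ∈ F, ‖haarCoeff g R.1‖ₑ ^ 2 = ENNReal.ofReal (∑ R ∈ F, ‖haarCoeff g R.1‖ ^ 2) := by
    rw [ENNReal.ofReal_sum_of_nonneg fun _ _ => by positivity]
    refine Finset.sum_congr rfl fun _ _ => ?_
    rw [ENNReal.ofReal_pow (norm_nonneg _), ofReal_norm]
  rw [ENNReal.tsum_eq_iSup_sum, iSup_le_iff, hr]
  refine forall_congr' fun F => ?_
  rw [hl, ENNReal.ofReal_le_ofReal_iff (by positivity)]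

theorem memLp_mul_ofReal {φ : Torus ι → 𝕜} (hφ : MemLp φ 2 volume) {g : Torus ι → ℝ}
    (hg : Measurable g) {c : ℝ} (hc : ∀ t, |g t| ≤ c) :
    MemLp (fun t => φ t * ((g t : ℝ) : 𝕜)) 2 volume := by
  have hg' : Measurable fun t => ((g t : ℝ) : 𝕜) := RCLike.measurable_ofReal.comp hg
  refine hφ.of_le_mul (c := c) (hφ.1.mul hg'.aestronglyMeasurable) (.of_forall fun t => ?_)
  rw [norm_mul, RCLike.norm_ofReal, mul_comm]
  exact mul_le_mul_of_nonneg_right (hc t) (norm_nonneg _)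

theorem memLp_mul_haar {φ : Torus ι → 𝕜} (hφ : MemLp φ 2 volume) (R : DyadicRectangle ι) :
    MemLp (fun t => φ t * ((R.haar t : ℝ) : 𝕜)) 2 volume := by
  exact memLp_mul_ofReal hφ R.measurable_haar R.abs_haar_le

/-- The Haar coefficient of `φ f` as a functional of `f ∈ L^∞`. -/
def haarCoeffMul {φ : Torus ι → 𝕜} (hφ : MemLp φ 2 volume) (R : DyadicRectangle ι) :
    Lp 𝕜 ∞ (volume : Measure (Torus ι)) →L[𝕜] 𝕜 :=
  (ContinuousLinearMap.mul 𝕜 𝕜).lpPairing volume 1 ∞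
    (((memLp_mul_haar hφ R).mono_exponent (by norm_num)).toLp _)

theorem haarCoeffMul_apply {φ : Torus ι → 𝕜} (hφ : MemLp φ 2 volume) (R : DyadicRectangle ι)
    (f : Lp 𝕜 ∞ (volume : Measure (Torus ι))) :
    haarCoeffMul hφ R f = haarCoeff (fun t => φ t * f t) R := by
  unfold haarCoeffMul haarCoeff
  rw [ContinuousLinearMap.lpPairing_eq_integral]
  refine integral_congr_ae ?_
  filter_upwards [((memLp_mul_haar hφ R).mono_exponent (q := 2) (p := 1) (by norm_num)).coeFn_toLp]
    with t ht
  rw [ht, ContinuousLinearMap.mul_apply']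
  ring

theorem haarCoeff_congr {f g : Torus ι → 𝕜} (h : f =ᵐ[volume] g) (R : DyadicRectangle ι) :
    haarCoeff f R = haarCoeff g R :=
  integral_congr_ae (h.mono fun t ht => by simp only [ht])

theorem dyadicBMONorm_congr {f g : Torus ι → 𝕜} (h : f =ᵐ[volume] g) :
    dyadicBMONorm f = dyadicBMONorm g := by
  unfold dyadicBMONorm
  simp only [haarCoeff_congr h]

/-- The family of continuous seminorms on `L^∞` whose supremum is the `BMO^d` norm of `φ f`. -/
def localSeminorm {φ : Torus ι → 𝕜} (hφ : MemLp φ 2 volume) (Ω : Set (Torus ι))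
    (F : Finset {R : DyadicRectangle ι // R.toSet ⊆ Ω}) :
    Seminorm 𝕜 (Lp 𝕜 ∞ (volume : Measure (Torus ι))) :=
  NNReal.sqrt (volume.real Ω)⁻¹.toNNReal •
    (normSeminorm 𝕜 (EuclideanSpace 𝕜 F)).comp
      ((EuclideanSpace.equiv F 𝕜).symm.toContinuousLinearMap ∘L
        ContinuousLinearMap.pi fun R : F => haarCoeffMul hφ R.1.1).toLinearMap

theorem continuous_localSeminorm {φ : Torus ι → 𝕜} (hφ : MemLp φ 2 volume) (Ω : Set (Torus ι))
    (F : Finset {R : DyadicRectangle ι // R.toSet ⊆ Ω}) : Continuous (localSeminorm hφ Ω F) :=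
  (continuous_norm.comp ((EuclideanSpace.equiv F 𝕜).symm.toContinuousLinearMap ∘L
    ContinuousLinearMap.pi fun R : F => haarCoeffMul hφ R.1.1).continuous).const_smul _

theorem localSeminorm_sq {φ : Torus ι → 𝕜} (hφ : MemLp φ 2 volume) (Ω : Set (Torus ι))
    (F : Finset {R : DyadicRectangle ι // R.toSet ⊆ Ω})
    (f : Lp 𝕜 ∞ (volume : Measure (Torus ι))) :
    localSeminorm hφ Ω F f ^ 2 =
      (volume.real Ω)⁻¹ * ∑ R ∈ F, ‖haarCoeff (fun t => φ t * f t) R.1‖ ^ 2 := by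
  have h : localSeminorm hφ Ω F f = (NNReal.sqrt (volume.real Ω)⁻¹.toNNReal : ℝ) *
      ‖(EuclideanSpace.equiv F 𝕜).symm fun R : F => haarCoeffMul hφ R.1.1 f‖ := rfl
  rw [h, mul_pow, EuclideanSpace.norm_sq_eq, Real.coe_sqrt, Real.sq_sqrt (NNReal.coe_nonneg _),
    Real.coe_toNNReal _ (by positivity), ← Finset.sum_coe_sort F]
  simp only [← haarCoeffMul_apply hφ]
  rfl

theorem localSeminorm_le_iff {φ : Torus ι → 𝕜} (hφ : MemLp φ 2 volume) {Ω : Set (Torus ι)}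
    (hΩ : IsOpen Ω) (hne : Ω.Nonempty) (F : Finset {R : DyadicRectangle ι // R.toSet ⊆ Ω})
    (f : Lp 𝕜 ∞ (volume : Measure (Torus ι))) (c : ℝ≥0) :
    localSeminorm hφ Ω F f ≤ c ↔
      ∑ R ∈ F, ‖haarCoeff (fun t => φ t * f t) R.1‖ ^ 2 ≤ (c : ℝ) ^ 2 * volume.real Ω := by
  have hpos : 0 < volume.real Ω :=
    ENNReal.toReal_pos (hΩ.measure_pos volume hne).ne' (measure_ne_top _ _)
  rw [← sq_le_sq₀ (apply_nonneg (localSeminorm hφ Ω F) f) c.coe_nonneg, localSeminorm_sq, inv_mul_le_iff₀ hpos, mul_comm]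

/-- A multiplier from `bmo` to `BMO^d` maps the unit ball of `L^∞` to a bounded set. -/
theorem exists_dyadicBMONorm_mul_le {φ : Torus ι → 𝕜} (hφ : MemLp φ 2 volume)
    (hmul : φ ∈ multipliers (littleBMO 𝕜 ι) (dyadicBMO 𝕜 ι)) :
    ∃ C : ℝ≥0, ∀ f : Torus ι → 𝕜, AEStronglyMeasurable f volume → (∀ t, ‖f t‖ ≤ 1) →
      dyadicBMONorm (fun t => φ t * f t) ≤ C := by
  let J := Σ Ω : {Ω : Set (Torus ι) // IsOpen Ω ∧ Ω.Nonempty},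
    Finset {R : DyadicRectangle ι // R.toSet ⊆ Ω.1}
  let p : J → Seminorm 𝕜 (Lp 𝕜 ∞ (volume : Measure (Torus ι))) :=
    fun j => localSeminorm hφ j.1.1 j.2
  have hbdd : BddAbove (Set.range p) := by
    rw [Seminorm.bddAbove_range_iff]
    intro f
    -- An `L^∞` class is bounded only almost everywhere; cutting it off to zero on the exceptional
    -- null set gives a representative bounded everywhere.
    obtain ⟨g, hg, hgb, hfg⟩ : ∃ g : Torus ι → 𝕜, AEStronglyMeasurable g volume ∧
        (∀ t, ‖g t‖ ≤ ‖f‖) ∧ f =ᵐ[volume] g := by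
      have hm := (Lp.stronglyMeasurable f).measurable
      have hs : MeasurableSet {t | ‖f t‖ ≤ ‖f‖} := measurableSet_le hm.norm measurable_const
      refine ⟨Set.indicator {t | ‖f t‖ ≤ ‖f‖} f,
        ((Lp.stronglyMeasurable f).indicator hs).aestronglyMeasurable, fun t => ?_, ?_⟩
      · by_cases h : ‖f t‖ ≤ ‖f‖ <;> simp [Set.indicator, h]
      · filter_upwards [ae_le_eLpNormEssSup (f := f) (μ := volume)] with t ht'
        have ht : ‖f t‖ ≤ ‖f‖ := by
          rw [Lp.norm_def, eLpNorm_exponent_top, ← toReal_enorm]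
          refine ENNReal.toReal_mono ?_ ht'
          rw [← eLpNorm_exponent_top]
          exact Lp.eLpNorm_ne_top f
        rw [Set.indicator_of_mem (show t ∈ {t | ‖f t‖ ≤ ‖f‖} from ht)]
    have hfin := (hmul g (mem_littleBMO_of_bounded hg hgb)).2
    have hcongr : (fun t => φ t * f t) =ᵐ[volume] fun t => φ t * g t :=
      hfg.mono fun t ht => by simp only [ht]
    rw [← dyadicBMONorm_congr hcongr] at hfin
    refine ⟨(dyadicBMONorm fun t => φ t * f t).toNNReal, ?_⟩
    rintro _ ⟨j, rfl⟩
    refine (localSeminorm_le_iff hφ j.1.2.1 j.1.2.2 j.2 f _).2 ?_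
    exact dyadicBMONorm_le_iff_finset.1 (ENNReal.coe_toNNReal hfin.ne).ge _ j.1.2.1 j.1.2.2 j.2
  -- Banach–Steinhaus: `L^∞` is complete, hence barrelled, so a pointwise bounded supremum of
  -- continuous seminorms is continuous.
  have hcont : Continuous (⨆ j, p j : Seminorm 𝕜 (Lp 𝕜 ∞ (volume : Measure (Torus ι)))) := by
    rw [Seminorm.coe_iSup_eq hbdd]
    exact Seminorm.continuous_iSup p (fun j => continuous_localSeminorm hφ j.1.1 j.2) hbdd
  obtain ⟨C, hC0, hC⟩ := Seminorm.bound_of_continuous_normedSpace _ hcont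
  refine ⟨C.toNNReal, fun f hf hf1 => ?_⟩
  have hfm : MemLp f ∞ volume := memLp_top_of_bound hf 1 (.of_forall hf1)
  have hnorm : ‖hfm.toLp f‖ ≤ 1 := by
    rw [Lp.norm_toLp]
    refine ENNReal.toReal_le_of_le_ofReal zero_le_one ?_
    rw [eLpNorm_exponent_top]
    exact eLpNormEssSup_le_of_ae_bound (.of_forall hf1)
  have hcongr : (fun t => φ t * hfm.toLp f t) =ᵐ[volume] fun t => φ t * f t :=
    hfm.coeFn_toLp.mono fun t ht => by simp only [ht]
  rw [← dyadicBMONorm_congr hcongr, dyadicBMONorm_le_iff_finset]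
  intro Ω hΩ hne F
  rw [← localSeminorm_le_iff hφ hΩ hne, Real.coe_toNNReal C hC0.le]
  calc localSeminorm hφ Ω F (hfm.toLp f) = p ⟨⟨Ω, hΩ, hne⟩, F⟩ (hfm.toLp f) := rfl
    _ ≤ (⨆ j, p j) (hfm.toLp f) := le_ciSup hbdd (⟨⟨Ω, hΩ, hne⟩, F⟩ : J) _
    _ ≤ C * ‖hfm.toLp f‖ := hC _
    _ ≤ C := mul_le_of_le_one_right hC0.le hnorm

end UniformBound

/-! ### Splitting the variables and passing to partial means. -/

section Glue

variable {𝕜 : Type} [RCLike 𝕜] {ι : Type} [DecidableEq ι] (S : Finset ι)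

theorem glue_apply_mem (s : Torus {i // i ∈ S}) (t : Torus {i // i ∉ S}) (i : {i // i ∈ S}) :
    glue S s t i = s i := dif_pos i.2

theorem glue_apply_notMem (s : Torus {i // i ∈ S}) (t : Torus {i // i ∉ S}) (i : {i // i ∉ S}) :
    glue S s t i = t i := dif_neg i.2

theorem measurableEmbedding_glue :
    MeasurableEmbedding
      (fun z : Torus {i // i ∈ S} × Torus {i // i ∉ S} => glue S z.1 z.2) :=
  (MeasurableEquiv.piEquivPiSubtypeProd
    (fun _ : ι => UnitAddCircle) (· ∈ S)).symm.measurableEmbedding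

theorem partialMean_eq (φ : Torus ι → 𝕜) (R : DyadicRectangle {i // i ∈ S})
    (t : Torus {i // i ∉ S}) :
    partialMean φ S R t = ((R.vol⁻¹ : ℝ) : 𝕜) * ∫ s in R.toSet, φ (glue S s t) := by
  unfold partialMean
  rw [setAverage_eq, measureReal_def, R.volume_toSet, ENNReal.toReal_ofReal R.vol_pos.le,
    RCLike.real_smul_eq_coe_mul]

/-- The rectangle `R × Q`. -/
def combine (R : DyadicRectangle {i // i ∈ S}) (Q : DyadicRectangle {i // i ∉ S}) :
    DyadicRectangle ι :=
  fun i => if h : i ∈ S then R ⟨i, h⟩ else Q ⟨i, h⟩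

variable {S}

theorem combine_apply_mem (R : DyadicRectangle {i // i ∈ S}) (Q : DyadicRectangle {i // i ∉ S})
    (i : {i // i ∈ S}) : combine S R Q i = R i := dif_pos i.2

theorem combine_apply_notMem (R : DyadicRectangle {i // i ∈ S})
    (Q : DyadicRectangle {i // i ∉ S}) (i : {i // i ∉ S}) : combine S R Q i = Q i := dif_neg i.2

theorem combine_right_injective (R : DyadicRectangle {i // i ∈ S}) :
    Function.Injective (combine S R) := fun Q Q' h => funext fun i => by
  rw [← combine_apply_notMem R Q i, h, combine_apply_notMem]

variable [Fintype ι]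

theorem measurePreserving_glue (S : Finset ι) :
    MeasurePreserving (fun z : Torus {i // i ∈ S} × Torus {i // i ∉ S} => glue S z.1 z.2) := by
  have h := (volume_preserving_piEquivPiSubtypeProd (fun _ : ι => UnitAddCircle) (· ∈ S)).symm
  convert h
  rfl

instance isProbabilityMeasure_volume_torus {κ : Type} [Fintype κ] :
    IsProbabilityMeasure (volume : Measure (Torus κ)) :=
  ⟨by simp [volume_pi, Measure.pi_univ]⟩

theorem memLp_partialMean (S : Finset ι) {φ : Torus ι → 𝕜} (hφ : MemLp φ 2 volume)
    (R : DyadicRectangle {i // i ∈ S}) : MemLp (partialMean φ S R) 2 volume := by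
  have h := memLp_two_setIntegral (hφ.comp_measurePreserving (measurePreserving_glue S)) R.toSet
  simp_rw [funext (partialMean_eq S φ R)]
  exact h.const_mul _

theorem haar_combine_glue (R : DyadicRectangle {i // i ∈ S}) (Q : DyadicRectangle {i // i ∉ S})
    (s : Torus {i // i ∈ S}) (t : Torus {i // i ∉ S}) :
    (combine S R Q).haar (glue S s t) = R.haar s * Q.haar t := by
  unfold DyadicRectangle.haar
  rw [← Fintype.prod_subtype_mul_prod_subtype (· ∈ S)]
  simp only [combine_apply_mem, combine_apply_notMem, glue_apply_mem, glue_apply_notMem]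
  congr!

theorem haarCoeff_mul_signHaar {φ : Torus ι → 𝕜} (hφ : MemLp φ 2 volume)
    (R : DyadicRectangle {i // i ∈ S}) (Q : DyadicRectangle {i // i ∉ S}) :
    haarCoeff (fun u => φ u * ((R.signHaar (fun i => u i) : ℝ) : 𝕜)) (combine S R Q) =
      ((√R.vol : ℝ) : 𝕜) * haarCoeff (partialMean φ S R) Q := by
  have hsign : Measurable fun u : Torus ι => R.signHaar (fun i => u i) :=
    R.measurable_signHaar.comp (measurable_pi_lambda _ fun i => measurable_pi_apply _)
  have hint : Integrable (fun u => φ u * ((R.signHaar (fun i => u i) : ℝ) : 𝕜) *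
      (((combine S R Q).haar u : ℝ) : 𝕜)) volume :=
    (memLp_mul_haar (memLp_mul_ofReal hφ hsign fun _ => R.abs_signHaar_le_one _) _).integrable
      (by norm_num)
  have hint' : Integrable (fun z : Torus {i // i ∈ S} × Torus {i // i ∉ S} =>
      φ (glue S z.1 z.2) * ((R.signHaar (fun i => glue S z.1 z.2 i) : ℝ) : 𝕜) *
      (((combine S R Q).haar (glue S z.1 z.2) : ℝ) : 𝕜)) := ((measurePreserving_glue S).integrable_comp hint.1).2 hint
  unfold haarCoeff
  rw [← (measurePreserving_glue S).integral_comp (measurableEmbedding_glue S),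
    Measure.volume_eq_prod, integral_prod_symm _ hint', ← integral_const_mul]
  refine integral_congr_ae (.of_forall fun t => ?_)
  have hs : 0 < √R.vol := Real.sqrt_pos.2 R.vol_pos
  -- For fixed `t`, the two Haar factors in `s` collapse to a multiple of `χ_R`.
  have hpt (s : Torus {i // i ∈ S}) :
      φ (glue S s t) * ((R.signHaar (fun i => glue S s t i) : ℝ) : 𝕜) *
        (((combine S R Q).haar (glue S s t) : ℝ) : 𝕜) =
      (((√R.vol)⁻¹ * Q.haar t : ℝ) : 𝕜) * R.toSet.indicator (fun s => φ (glue S s t)) s := by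
    simp only [glue_apply_mem]
    rw [mul_assoc, ← RCLike.ofReal_mul, haar_combine_glue, ← mul_assoc, R.signHaar_mul_haar]
    by_cases h : s ∈ R.toSet
    · simp only [Set.indicator_of_mem h, Pi.one_apply, mul_one]
      exact mul_comm _ _
    · simp [Set.indicator_of_notMem h]
  simp only [hpt]
  rw [integral_const_mul, integral_indicator R.measurableSet_toSet, partialMean_eq]
  have hv : (√R.vol)⁻¹ = √R.vol * R.vol⁻¹ := by
    rw [← div_eq_mul_inv, Real.sqrt_div_self]
  rw [hv]
  push_cast
  ring

theorem dyadicBMONorm_partialMean_le {φ : Torus ι → 𝕜} (hφ : MemLp φ 2 volume) {C : ℝ≥0}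
    (hC : ∀ f : Torus ι → 𝕜, AEStronglyMeasurable f volume → (∀ t, ‖f t‖ ≤ 1) →
      dyadicBMONorm (fun t => φ t * f t) ≤ C) (R : DyadicRectangle {i // i ∈ S}) :
    dyadicBMONorm (partialMean φ S R) ≤ (NNReal.sqrt 2 * C : ℝ≥0) := by
  rw [dyadicBMONorm_le_iff]
  intro Ω hΩ hne
  set v : ℝ≥0∞ := ENNReal.ofReal R.vol
  have hv0 : v ≠ 0 := (ENNReal.ofReal_pos.2 R.vol_pos).ne'
  have hvt : v ≠ ∞ := ENNReal.ofReal_ne_top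
  -- `R` is half-open, whereas `BMO^d` is tested on open sets. Outer regularity with excess `|R|`
  -- costs the factor `2`, the source of `√2` in the constant.
  obtain ⟨U, hRU, hU, hUv⟩ := R.toSet.exists_isOpen_le_add volume hv0
  rw [R.volume_toSet, ← two_mul] at hUv
  set Ω' : Set (Torus ι) := {u | (fun i : {i // i ∈ S} => u i) ∈ U ∧
    (fun i : {i // i ∉ S} => u i) ∈ Ω} with hΩ'def
  have hΩ' : IsOpen Ω' :=
    (hU.preimage (continuous_pi fun i : {i // i ∈ S} => continuous_apply i.1)).inter
      (hΩ.preimage (continuous_pi fun i : {i // i ∉ S} => continuous_apply i.1))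
  have hpre : (fun z : Torus {i // i ∈ S} × Torus {i // i ∉ S} => glue S z.1 z.2) ⁻¹' Ω' =
      U ×ˢ Ω := by
    ext z
    simp [hΩ'def, glue_apply_mem, glue_apply_notMem]
  have hvol : volume Ω' = volume U * volume Ω := by
    rw [← (measurePreserving_glue S).measure_preimage hΩ'.measurableSet.nullMeasurableSet, hpre,
      Measure.volume_eq_prod, Measure.prod_prod]
  have hne' : Ω'.Nonempty := by
    rw [Set.nonempty_iff_ne_empty]
    intro h
    rw [h, measure_empty, eq_comm, mul_eq_zero] at hvol
    rcases hvol with h0 | h0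
    · exact hv0 (R.volume_toSet.symm.trans (measure_mono_null hRU h0))
    · exact (hΩ.measure_pos volume hne).ne' h0
  have hsub (Q : {Q : DyadicRectangle {i // i ∉ S} // Q.toSet ⊆ Ω}) :
      (combine S R Q.1).toSet ⊆ Ω' := by
    intro u hu
    refine ⟨hRU fun i _ => ?_, Q.2 fun i _ => ?_⟩
    · have h : u i ∈ (combine S R Q.1 i).toSet := hu i.1 trivial
      rwa [combine_apply_mem] at h
    · have h : u i ∈ (combine S R Q.1 i).toSet := hu i.1 trivial
      rwa [combine_apply_notMem] at h
  set f : Torus ι → 𝕜 := fun u => ((R.signHaar (fun i => u i) : ℝ) : 𝕜)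
  have hf : Measurable f := RCLike.measurable_ofReal.comp
    (R.measurable_signHaar.comp (measurable_pi_lambda _ fun i => measurable_pi_apply _))
  have hbound := dyadicBMONorm_le_iff.1 (hC f hf.aestronglyMeasurable fun u => by
    rw [RCLike.norm_ofReal]; exact R.abs_signHaar_le_one _) Ω' hΩ' hne'
  have hcoeff (Q : DyadicRectangle {i // i ∉ S}) :
      ‖haarCoeff (fun u => φ u * f u) (combine S R Q)‖ₑ ^ 2 =
        v * ‖haarCoeff (partialMean φ S R) Q‖ₑ ^ 2 := by
    rw [haarCoeff_mul_signHaar hφ, enorm_mul, mul_pow]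
    congr 1
    rw [← ofReal_norm, RCLike.norm_ofReal, ← ENNReal.ofReal_pow (abs_nonneg _), sq_abs,
      Real.sq_sqrt R.vol_pos.le]
  refine (ENNReal.mul_le_mul_iff_right hv0 hvt).1 ?_
  calc v * ∑' Q : {Q : DyadicRectangle {i // i ∉ S} // Q.toSet ⊆ Ω},
        ‖haarCoeff (partialMean φ S R) Q.1‖ₑ ^ 2
      = ∑' Q : {Q : DyadicRectangle {i // i ∉ S} // Q.toSet ⊆ Ω},
        ‖haarCoeff (fun u => φ u * f u) (combine S R Q.1)‖ₑ ^ 2 := by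
        simp only [hcoeff, ENNReal.tsum_mul_left]
    _ ≤ ∑' P : {P : DyadicRectangle ι // P.toSet ⊆ Ω'},
        ‖haarCoeff (fun u => φ u * f u) P.1‖ₑ ^ 2 :=
        -- The rectangles `R × Q` with `Q ⊆ Ω` are distinct and lie in `U × Ω`, so their sum is part
        -- of the full one.
        ENNReal.tsum_comp_le_tsum_of_injective
          (f := fun Q : {Q : DyadicRectangle {i // i ∉ S} // Q.toSet ⊆ Ω} =>
            (⟨combine S R Q.1, hsub Q⟩ : {P : DyadicRectangle ι // P.toSet ⊆ Ω'}))
          (fun Q Q' h => Subtype.ext (combine_right_injective R (congrArg Subtype.val h)))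
          fun P => ‖haarCoeff (fun u => φ u * f u) P.1‖ₑ ^ 2
    _ ≤ (C : ℝ≥0∞) ^ 2 * volume Ω' := hbound
    _ ≤ (C : ℝ≥0∞) ^ 2 * (2 * v * volume Ω) := by rw [hvol]; gcongr
    _ = v * (((NNReal.sqrt 2 * C : ℝ≥0) : ℝ≥0∞) ^ 2 * volume Ω) := by
        rw [ENNReal.coe_mul, mul_pow, ← ENNReal.coe_pow (NNReal.sqrt 2), NNReal.sq_sqrt,
          ENNReal.coe_ofNat]
        ring

end Glue

end ProductBMO

end

theorem proposition4p2 {𝕜 : Type} [RCLike 𝕜] (N : ℕ)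
    (φ : ProductBMO.Torus (Fin N) → 𝕜) (hφ : MemLp φ 2 volume)
    (hmul : φ ∈ ProductBMO.multipliers (ProductBMO.littleBMO 𝕜 (Fin N))
      (ProductBMO.dyadicBMO 𝕜 (Fin N))) :
    φ ∈ ProductBMO.meanDyadicBMO 𝕜 (Fin N) := by
  obtain ⟨C, hC⟩ := ProductBMO.exists_dyadicBMONorm_mul_le hφ hmul
  refine ⟨hφ, NNReal.sqrt 2 * C, fun S _ _ R => ?_⟩
  have h := ProductBMO.dyadicBMONorm_partialMean_le hφ hC R
  exact ⟨⟨ProductBMO.memLp_partialMean S hφ R, h.trans_lt ENNReal.coe_lt_top⟩, h⟩
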